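/- A hypergraph $\mathcal H$ consists of a finite vertex set $V(\mathcal H)$ and a set $E(\mathcal H)$ of distinct subsets of $V(\mathcal H)$, its edges (no multiple edges; edges of any size, including the empty set and singletons, are allowed). Write $e(\mathcal H)=|E(\mathcal H)|$. A Berge cycle of length $\ell$ in $\mathcal H$ consists of $\ell$ distinct vertices $v_1,\dots,v_\ell$ and $\ell$ distinct edges $e_1,\dots,e_\ell$ of $\mathcal H$ such that $\{v_i,v_{i+1}\}\subseteq e_i$ for all $1\le i\le \ell$, with indices taken modulo $\ell$. Theorem. Let $n\ge k\ge 3$ be integers. If $\mathcal H$ is a hypergraph with $n$ vertices that contains no Berge cycle of length $k$ or longer, then $$e(\mathcal H)\le 2+\frac{n-1}{k-2}\left(2^{k-1}-2\right).$$ Moreover, if $n\equiv 1 \pmod{k-2}$, then there is a hypergraph with $n$ vertices and no Berge cycle of length $k$ or longer for which equality holds. -/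

import Mathlib

/-- `H` has a Berge cycle of length `ℓ`: there are `ℓ` distinct vertices `v 0, …, v (ℓ - 1)` and
`ℓ` distinct hyperedges `e 0, …, e (ℓ - 1)` with `{v i, v (i + 1)} ⊆ e i`, indices modulo `ℓ`
(`finRotate ℓ` is the cyclic shift `i ↦ i + 1` of `Fin ℓ`). -/
def Hypergraph.HasBergeCycle {α : Type*} (H : Hypergraph α) (ℓ : ℕ) : Prop :=
  0 < ℓ ∧ ∃ (v : Fin ℓ → α) (e : Fin ℓ → Set α),
    Function.Injective v ∧ Function.Injective e ∧
    (∀ i, v i ∈ H.vertexSet) ∧ (∀ i, e i ∈ H.edgeSet) ∧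
    ∀ i, {v i, v (finRotate ℓ i)} ⊆ e i

open Finset

/-! The bound reduces to counting cliques in a graph. A set of maximum deficiency in the incidence
between hyperedges and vertex pairs yields a set `P` of pairs that injects into the hyperedges, each
pair going to a hyperedge containing it. A long cycle in the graph `G` with edge set `P` would
therefore be a long Berge cycle. The hyperedges are either cliques of `G` or matched to further
distinct edges of `G`, so there are at most as many as cliques (`exists_graph_card_le_cliquesIn`).
Put `K = k - 2`. The cliques are counted by induction on vertices (`mul_card_cliquesIn_add_le`).
Pósa rotations of the tail of a longest path produce a set of `s ≤ K` endpoints, each of degree at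
most `s`, with all neighbours among at most `K + 1` tail vertices. Deleting the endpoints one by one
destroys at most `∑ i < s, 2 ^ min s (K - i)` cliques, and `mul_sum_two_pow_min_add_le` shows that
this fits the bound. Equality holds for all subsets of `(k - 1)`-sets glued at one common vertex. -/

/-! ### The numerical inequality -/

lemma sum_two_pow_min_add_le (s u t : ℕ) (h₁ : u + 1 ≤ t) (h₂ : t ≤ s + u) :
    ∑ i ∈ range t, 2 ^ min s (s + u - i) + 2 ^ (s + u + 1 - t) ≤ (u + 2) * 2 ^ s := by
  induction t, h₁ using Nat.le_induction with
  | base =>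
    have h : ∑ i ∈ range (u + 1), 2 ^ min s (s + u - i) ≤ ∑ i ∈ range (u + 1), 2 ^ s :=
      sum_le_sum fun i _ => Nat.pow_le_pow_right (by norm_num) (min_le_left _ _)
    rw [sum_const, card_range, smul_eq_mul] at h
    have h' : s + u + 1 - (u + 1) = s := by omega
    rw [h']
    linarith
  | succ t ht ih =>
    have h := ih (by omega)
    rw [sum_range_succ]
    -- Past index `u` the terms halve; the extra summand is twice the next term, so the sum
    -- telescopes.
    have e₁ : min s (s + u - t) = s + u - t := by omega
    have e₂ : s + u + 1 - (t + 1) = s + u - t := by omega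
    have e₃ : s + u + 1 - t = (s + u - t) + 1 := by omega
    rw [e₃, pow_succ] at h
    rw [e₁, e₂]
    linarith

lemma mul_sum_two_pow_min_add_le (s K : ℕ) (hs : 1 ≤ s) (hK : s ≤ K) :
    K * ∑ i ∈ range s, 2 ^ min s (K - i) + 2 * s ≤ s * 2 ^ (K + 1) := by
  obtain ⟨u, rfl⟩ := Nat.exists_eq_add_of_le hK
  have hF : ∑ i ∈ range s, 2 ^ min s (s + u - i) ≤ s * 2 ^ s := by
    have h : ∑ i ∈ range s, 2 ^ min s (s + u - i) ≤ ∑ i ∈ range s, 2 ^ s :=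
      sum_le_sum fun i _ => Nat.pow_le_pow_right (by norm_num) (min_le_left _ _)
    simpa using h
  have e : 2 ^ (s + u + 1) = 2 * 2 ^ s * 2 ^ u := by ring
  have hpos : 2 ≤ 2 ^ s := by
    calc 2 = 2 ^ 1 := rfl
      _ ≤ 2 ^ s := Nat.pow_le_pow_right (by norm_num) hs
  rw [e]
  -- For `s ≤ u` the crude bound `2 ^ s` per term suffices; otherwise the geometric tail is needed.
  rcases le_or_gt s u with hsu | hsu
  · have hu : u + 1 ≤ 2 ^ u := Nat.lt_two_pow_self
    generalize 2 ^ s = a at *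
    generalize 2 ^ u = b at *
    generalize ∑ i ∈ range s, 2 ^ min s (s + u - i) = F at *
    have h1 : (s + u) * F ≤ (s + u) * (s * a) := Nat.mul_le_mul_left _ hF
    have h2 : s * a * (s + u + 1) ≤ s * a * (2 * b) := Nat.mul_le_mul_left _ (by omega)
    have h3 : s * 2 ≤ s * a := Nat.mul_le_mul_left _ hpos
    nlinarith
  · have hG := sum_two_pow_min_add_le s u s hsu (by omega)
    have e' : s + u + 1 - s = u + 1 := by omega
    rw [e', pow_succ] at hG
    have h1 : ∀ F c, F + 2 ^ u * 2 ≤ c → (s + u) * F + (s + u) * (2 ^ u * 2) ≤ (s + u) * c :=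
      fun F c h => by rw [← mul_add]; exact Nat.mul_le_mul_left _ h
    have h2 := h1 _ _ hG
    generalize ∑ i ∈ range s, 2 ^ min s (s + u - i) = F at *
    rcases Nat.lt_or_ge u 2 with hu | hu
    · interval_cases u
      · nlinarith
      · rcases Nat.lt_or_ge s 3 with h3 | h3
        · have : s = 2 := by omega
          subst this
          omega
        · have : 3 * 2 ^ s ≤ s * 2 ^ s := Nat.mul_le_mul_right _ h3
          nlinarith
    · have hu' : u + 2 ≤ 2 ^ u := by
        clear h1 h2 hG hF hK hsu e e'
        induction u, hu using Nat.le_induction with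
        | base => norm_num
        | succ u hu ih => rw [pow_succ]; omega
      have h3 : (s + u) * ((u + 2) * 2 ^ s) ≤ 2 * s * (2 ^ u * 2 ^ s) :=
        Nat.mul_le_mul (by omega) (Nat.mul_le_mul_right _ hu')
      have h4 : 1 ≤ 2 ^ u := Nat.one_le_two_pow
      have h5 : (s + u) * 2 ≤ (s + u) * (2 ^ u * 2) := Nat.mul_le_mul_left _ (by omega)
      nlinarith

/-! ### Matchings from maximum deficiency -/

/-- Both halves of the bipartite graph between `E` and its neighbours, split at a subset `A` of
maximum deficiency, have a perfect matching of the smaller side. -/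
theorem exists_subset_matchings {ι β : Type*} [DecidableEq ι] [DecidableEq β] (E : Finset ι)
    (t : ι → Finset β) :
    ∃ A ⊆ E,
      (∃ g : {e // e ∈ E \ A} → β, Function.Injective g ∧ ∀ e, g e ∈ t e.1 \ A.biUnion t) ∧
      ∃ h : {p // p ∈ A.biUnion t} → ι, Function.Injective h ∧
        ∀ p, h p ∈ A ∧ p.1 ∈ t (h p) := by
  -- A violation of Hall's condition in either half would raise the deficiency, by enlarging `A` in
  -- the first half or shrinking it in the second.
  obtain ⟨A, hA, hmax⟩ := exists_max_image E.powerset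
    (fun A => (#A : ℤ) - #(A.biUnion t)) ⟨∅, by simp⟩
  rw [mem_powerset] at hA
  refine ⟨A, hA, ?_, ?_⟩
  · apply (all_card_le_biUnion_card_iff_exists_injective
      (fun e : {e // e ∈ E \ A} => t e \ A.biUnion t)).1
    intro B
    set B' := B.map (Function.Embedding.subtype _) with hB'
    have hBs : B' ⊆ E \ A := by
      intro x hx
      simp only [hB', mem_map, Function.Embedding.subtype_apply] at hx
      obtain ⟨y, -, rfl⟩ := hx
      exact y.2
    have hcard : #B' = #B := card_map _
    have hm := hmax (A ∪ B') (mem_powerset.2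
      (union_subset hA (hBs.trans sdiff_subset)))
    have hd : Disjoint A B' := disjoint_of_subset_right hBs disjoint_sdiff
    have hu : (A ∪ B').biUnion t =
        A.biUnion t ∪ B.biUnion (fun e : {e // e ∈ E \ A} => t e \ A.biUnion t) := by
      ext p
      simp only [hB', mem_biUnion, mem_union, mem_map, Function.Embedding.subtype_apply, mem_sdiff]
      constructor
      · rintro ⟨e, he | ⟨y, hy, rfl⟩, hp⟩
        · exact Or.inl ⟨e, he, hp⟩
        · by_cases h : ∃ a ∈ A, p ∈ t a
          · exact Or.inl h
          · exact Or.inr ⟨y, hy, hp, h⟩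
      · rintro (⟨e, he, hp⟩ | ⟨y, hy, hp, -⟩)
        · exact ⟨e, Or.inl he, hp⟩
        · exact ⟨y, Or.inr ⟨y, hy, rfl⟩, hp⟩
    have hle := card_union_le (A.biUnion t)
      (B.biUnion (fun e : {e // e ∈ E \ A} => t e \ A.biUnion t))
    rw [hu, card_union_of_disjoint hd] at hm
    push_cast at hm
    omega
  · obtain ⟨h, hinj, hmem⟩ := (all_card_le_biUnion_card_iff_exists_injective
      (fun p : {p // p ∈ A.biUnion t} => {e ∈ A | p.1 ∈ t e})).1 (by
        intro Q
        set Q' := Q.map (Function.Embedding.subtype _) with hQ'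
        have hQs : Q' ⊆ A.biUnion t := by
          intro x hx
          simp only [hQ', mem_map, Function.Embedding.subtype_apply] at hx
          obtain ⟨y, -, rfl⟩ := hx
          exact y.2
        have hcard : #Q' = #Q := card_map _
        set D := Q.biUnion (fun p : {p // p ∈ A.biUnion t} => {e ∈ A | p.1 ∈ t e}) with hD
        have hDA : D ⊆ A := biUnion_subset.2 fun p _ => filter_subset _ _
        have hm := hmax (A \ D) (mem_powerset.2 (sdiff_subset.trans hA))
        have hsub : (A \ D).biUnion t ⊆ A.biUnion t \ Q' := by
          intro p hp
          simp only [mem_biUnion, mem_sdiff] at hp ⊢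
          obtain ⟨e, ⟨heA, heD⟩, hpe⟩ := hp
          refine ⟨⟨e, heA, hpe⟩, fun hq => heD ?_⟩
          simp only [hQ', mem_map, Function.Embedding.subtype_apply] at hq
          obtain ⟨y, hy, rfl⟩ := hq
          exact mem_biUnion.2 ⟨y, hy, mem_filter.2 ⟨heA, hpe⟩⟩
        have h1 := card_le_card hsub
        rw [card_sdiff_of_subset hQs] at h1
        rw [card_sdiff_of_subset hDA] at hm
        have h2 := card_le_card hDA
        have h3 := card_le_card hQs
        omega)
    exact ⟨h, hinj, fun p => by simpa using hmem p⟩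

/-- There is a set `P` of neighbours, matched injectively into `E`, such that the members of `E`
either have all their neighbours in `P`, or are matched to distinct elements of `P` that are not
neighbours of any member of the first kind. -/
theorem exists_matched_set {ι β : Type*} [DecidableEq ι] [DecidableEq β] (E : Finset ι)
    (t : ι → Finset β) :
    ∃ A ⊆ E, ∃ (P : Finset β) (f : {p // p ∈ P} → ι) (g : {e // e ∈ E \ A} → β),
      Function.Injective f ∧ (∀ p, f p ∈ E ∧ p.1 ∈ t (f p)) ∧
      Function.Injective g ∧ (∀ e, g e ∈ P ∧ g e ∈ t e.1) ∧
      ∀ a ∈ A, t a ⊆ P ∧ ∀ e, g e ∉ t a := by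
  obtain ⟨A, hA, ⟨g, hg, hgt⟩, h, hh, hht⟩ := exists_subset_matchings E t
  have hgA : ∀ e, ∀ a ∈ A, g e ∉ t a := fun e a ha hm =>
    (mem_sdiff.1 (hgt e)).2 (mem_biUnion.2 ⟨a, ha, hm⟩)
  have hex : ∀ p : {p // p ∈ A.biUnion t ∪ univ.image g}, p.1 ∉ A.biUnion t →
      ∃ e, g e = p.1 := by
    intro p hp
    simpa using (mem_union.1 p.2).resolve_left hp
  choose c hc using hex
  refine ⟨A, hA, A.biUnion t ∪ univ.image g,
    fun p => if hp : p.1 ∈ A.biUnion t then h ⟨p.1, hp⟩ else c p hp, g, ?_, ?_, hg,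
    fun e => ⟨mem_union_right _ (mem_image_of_mem g (mem_univ e)), (mem_sdiff.1 (hgt e)).1⟩,
    fun a ha => ⟨(subset_biUnion_of_mem t ha).trans subset_union_left, fun e => hgA e a ha⟩⟩
  · intro p q hpq
    by_cases hp : p.1 ∈ A.biUnion t <;> by_cases hq : q.1 ∈ A.biUnion t <;>
      simp only [hp, hq, dite_true, dite_false] at hpq
    · exact Subtype.ext (Subtype.mk.inj (hh hpq))
    · exact absurd (hpq ▸ (hht ⟨p.1, hp⟩).1) (mem_sdiff.1 (c q hq).2).2
    · exact absurd (hpq ▸ (hht ⟨q.1, hq⟩).1) (mem_sdiff.1 (c p hp).2).2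
    · exact Subtype.ext ((hc p hp).symm.trans ((congrArg g (Subtype.ext hpq)).trans (hc q hq)))
  · intro p
    by_cases hp : p.1 ∈ A.biUnion t <;> simp only [hp, dite_true, dite_false]
    · exact ⟨hA (hht ⟨p.1, hp⟩).1, (hht ⟨p.1, hp⟩).2⟩
    · refine ⟨(mem_sdiff.1 (c p hp).2).1, ?_⟩
      have h' := (mem_sdiff.1 (hgt (c p hp))).1
      rwa [hc p hp] at h'

/-! ### Path rotations and clique counting -/

lemma List.IsChain.rotate_end {α : Type*} {G : SimpleGraph α} {P Q : List α} {x u : α}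
    (h : List.IsChain G.Adj (P ++ [x] ++ Q)) (hu : Q.getLast? = some u) (hxu : G.Adj u x) :
    List.IsChain G.Adj (P ++ [x] ++ Q.reverse) := by
  rw [List.isChain_append] at h ⊢
  refine ⟨h.1, ?_, ?_⟩
  · rw [List.isChain_reverse]
    exact h.2.1.imp fun a b hab => hab.symm
  · intro a ha b hb
    simp only [List.head?_reverse, hu, List.getLast?_append, List.getLast?_singleton,
      Option.some_or, Option.mem_def, Option.some.injEq] at ha hb
    subst ha hb
    exact hxu.symm

namespace SimpleGraph

variable {α : Type*} (G : SimpleGraph α)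

open Classical in
/-- The cliques of `G`, of any size, contained in `X`. -/
noncomputable def cliquesIn (X : Finset α) : Finset (Finset α) :=
  {Q ∈ X.powerset | G.IsClique (Q : Set α)}

lemma mem_cliquesIn {X Q : Finset α} : Q ∈ G.cliquesIn X ↔ Q ⊆ X ∧ G.IsClique (Q : Set α) := by
  simp [cliquesIn]

open Classical in
lemma card_cliquesIn_le_erase (X : Finset α) (u : α) :
    #(G.cliquesIn X) ≤ #(G.cliquesIn (X.erase u)) + 2 ^ #{x ∈ X | G.Adj u x} := by
  rw [← card_filter_add_card_filter_not (s := G.cliquesIn X) (fun Q => u ∉ Q)]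
  gcongr
  · intro Q hQ
    simp only [mem_filter, mem_cliquesIn] at hQ ⊢
    exact ⟨subset_erase.2 ⟨hQ.1.1, hQ.2⟩, hQ.1.2⟩
  · rw [← card_powerset]
    apply card_le_card_of_injOn (fun Q => Q.erase u)
    · intro Q hQ
      simp only [coe_filter, Set.mem_ofPred_eq, mem_cliquesIn, not_not] at hQ
      simp only [coe_powerset, Set.mem_preimage, Set.mem_powerset_iff, coe_subset]
      intro x hx
      rw [mem_erase] at hx
      exact mem_filter.2 ⟨hQ.1.1 hx.2, hQ.1.2 hQ.2 hx.2 hx.1.symm⟩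
    · intro Q hQ Q' hQ' h
      simp only [coe_filter, Set.mem_ofPred_eq, not_not] at hQ hQ'
      have h' : Q.erase u = Q'.erase u := h
      rw [← insert_erase hQ.2, h', insert_erase hQ'.2]

open Classical in
-- Remove `T` vertex by vertex: after `i` removals, the next vertex has at most `d` neighbours left,
-- all in `W` minus itself and the `i` removed vertices.
lemma card_cliquesIn_le_sdiff (X W T : Finset α) (d : ℕ)
    (hTW : T ⊆ W) (hW : ∀ u ∈ T, ∀ x ∈ X, G.Adj u x → x ∈ W)
    (hd : ∀ u ∈ T, #{x ∈ X | G.Adj u x} ≤ d) :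
    #(G.cliquesIn X) ≤ #(G.cliquesIn (X \ T)) + ∑ i ∈ range #T, 2 ^ min d (#W - 1 - i) := by
  induction T using Finset.induction_on with
  | empty => simp
  | insert u T hu ih =>
    have ih' := ih ((subset_insert u T).trans hTW) (fun v hv => hW v (mem_insert_of_mem hv))
      (fun v hv => hd v (mem_insert_of_mem hv))
    have h := G.card_cliquesIn_le_erase (X \ T) u
    have e : (X \ T).erase u = X \ insert u T := by
      ext x; simp only [mem_erase, mem_sdiff, mem_insert]; tauto
    have hle : 2 ^ #{x ∈ X \ T | G.Adj u x} ≤ 2 ^ min d (#W - 1 - #T) := by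
      apply Nat.pow_le_pow_right (by norm_num)
      apply le_min
      · exact (card_le_card (filter_subset_filter _ sdiff_subset)).trans
          (hd u (mem_insert_self u T))
      · have hs : {x ∈ X \ T | G.Adj u x} ⊆ W \ insert u T := by
          intro x hx
          simp only [mem_filter, mem_sdiff, mem_insert] at hx ⊢
          refine ⟨hW u (mem_insert_self u T) x hx.1.1 hx.2, ?_⟩
          rintro (rfl | hxT)
          · exact G.loopless.irrefl _ hx.2
          · exact hx.1.2 hxT
        have := card_le_card hs
        rw [card_sdiff_of_subset hTW, card_insert_of_notMem hu] at this
        omega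
    rw [e] at h
    rw [card_insert_of_notMem hu, sum_range_succ]
    omega

/-- A list of distinct elements of `X` that are consecutively adjacent in `G`. -/
def IsPathIn (X : Finset α) (L : List α) : Prop :=
  L.Nodup ∧ L.IsChain G.Adj ∧ ∀ x ∈ L, x ∈ X

variable {G}

lemma exists_longest_isPathIn {X : Finset α} {x y : α} (hx : x ∈ X) (hy : y ∈ X)
    (hxy : G.Adj x y) :
    ∃ L, G.IsPathIn X L ∧ 2 ≤ L.length ∧ ∀ L', G.IsPathIn X L' → L'.length ≤ L.length := by
  classical
  have hb : BddAbove {m | ∃ L, G.IsPathIn X L ∧ L.length = m} := by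
    refine ⟨#X, ?_⟩
    rintro m ⟨L, hL, rfl⟩
    rw [← List.toFinset_card_of_nodup hL.1]
    exact card_le_card fun z hz => hL.2.2 z (List.mem_toFinset.1 hz)
  have h2 : G.IsPathIn X [x, y] := by
    refine ⟨by simpa using hxy.ne, by simpa using hxy, ?_⟩
    simp [hx, hy]
  obtain ⟨L, hL, hlen⟩ := Nat.sSup_mem (s := {m | ∃ L, G.IsPathIn X L ∧ L.length = m})
    ⟨2, [x, y], h2, rfl⟩ hb
  refine ⟨L, hL, ?_, fun L' hL' => ?_⟩
  · rw [hlen]; exact le_csSup hb ⟨_, h2, rfl⟩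
  · rw [hlen]; exact le_csSup hb ⟨_, hL', rfl⟩

/-- Cuts off the last `K + 1` vertices, or the whole path if it is shorter. Rotations will fix `A`
and the pivot `b` and permute only `B`. -/
lemma exists_split_longest {K : ℕ} {L : List α} (hK : 1 ≤ K) (h2 : 2 ≤ L.length) :
    ∃ A b B, L = A ++ b :: B ∧ 1 ≤ B.length ∧ B.length ≤ K ∧ (A ≠ [] → B.length = K) := by
  set m := L.length - (K + 1) with hm
  obtain ⟨b, B, hB⟩ : ∃ b B, L.drop m = b :: B := by
    apply List.exists_cons_of_ne_nil
    rw [ne_eq, List.drop_eq_nil_iff]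
    omega
  have hl := congrArg List.length hB
  rw [List.length_drop, List.length_cons] at hl
  refine ⟨L.take m, b, B, by rw [← hB, List.take_append_drop], by omega, by omega, fun hA => ?_⟩
  have : m ≠ 0 := fun h => hA (by simp [h])
  omega

/-- A neighbour of the end `u` off the path would lengthen it; one in `A` would close a cycle
through `b` and the `K` vertices after it, of length at least `K + 2`. -/
lemma mem_of_adj_end {X : Finset α} {K : ℕ}
    (hG : ∀ L : List α, L.Nodup → L.IsChain G.Adj → K + 2 ≤ L.length → ∀ h : L ≠ [],
      ¬ G.Adj (L.getLast h) (L.head h))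
    {A D : List α} {b u x : α} (hP : G.IsPathIn X (A ++ b :: (D ++ [u])))
    (hmax : ∀ L', G.IsPathIn X L' → L'.length ≤ (A ++ b :: (D ++ [u])).length)
    (hA : A ≠ [] → (D ++ [u]).length = K) (hx : x ∈ X) (hux : G.Adj u x) :
    x ∈ b :: D := by
  have hmem : x ∈ A ++ b :: (D ++ [u]) := by
    by_contra hn
    have h := hmax (A ++ b :: (D ++ [u]) ++ [x]) ⟨?_, ?_, ?_⟩
    · simp at h
    · rw [List.nodup_append]
      refine ⟨hP.1, by simp, ?_⟩
      intro a ha c hc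
      rw [List.mem_singleton] at hc
      subst hc
      rintro rfl
      exact hn ha
    · rw [List.isChain_append]
      refine ⟨hP.2.1, by simp, ?_⟩
      intro a ha c hc
      have ha' : u = a := by
        simpa [List.getLast?_append, List.getLast?_cons] using ha
      have hc' : x = c := by simpa using hc
      subst ha' hc'
      exact hux
    · intro z hz
      rw [List.mem_append, List.mem_singleton] at hz
      rcases hz with hz | rfl
      · exact hP.2.2 z hz
      · exact hx
  rw [List.mem_append] at hmem
  rcases hmem with hxA | hxB
  · exfalso
    have hne : A ≠ [] := List.ne_nil_of_mem hxA
    obtain ⟨A₁, A₂, rfl⟩ := List.append_of_mem hxA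
    have e : A₁ ++ x :: A₂ ++ b :: (D ++ [u]) = A₁ ++ (x :: (A₂ ++ b :: (D ++ [u]))) := by simp
    rw [e] at hP
    have hl := hA hne
    refine hG (x :: (A₂ ++ b :: (D ++ [u]))) (List.nodup_append.1 hP.1).2.1
      (List.isChain_append.1 hP.2.1).2.1 ?_ (by simp) ?_
    · simp only [List.length_cons, List.length_append] at hl ⊢
      omega
    · have : (x :: (A₂ ++ b :: (D ++ [u]))).getLast (by simp) = u := by
        simp [List.getLast_cons]
      rw [this]
      exact hux
  · rw [← List.cons_append, List.mem_append, List.mem_singleton] at hxB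
    rcases hxB with h | rfl
    · exact h
    · exact absurd hux (G.loopless.irrefl _)

/-- Reversing the part after `x` makes its successor `y` the new end. As `x` is not before `b`, the
initial segment up to `b` survives. -/
lemma exists_rotation {X : Finset α} {A D : List α} {b u x : α}
    (hP : G.IsPathIn X (A ++ b :: (D ++ [u]))) (hx : x ∈ b :: D) (hux : G.Adj u x) :
    ∃ C y D', b :: (D ++ [u]) = C ++ x :: y :: D' ∧
      ∃ D'', (D'' ++ [y]).Perm (D ++ [u]) ∧ G.IsPathIn X (A ++ b :: (D'' ++ [y])) := by
  obtain ⟨C, E, hCE⟩ := List.append_of_mem hx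
  obtain ⟨y, D', hy⟩ : ∃ y D', E ++ [u] = y :: D' :=
    List.exists_cons_of_ne_nil (by simp)
  have hM : b :: (D ++ [u]) = C ++ x :: y :: D' := by
    rw [← List.cons_append, hCE, ← hy]; simp
  have hlast : (y :: D').getLast? = some u := by rw [← hy]; simp
  refine ⟨C, y, D', hM, ?_⟩
  have key : ∀ D'', b :: (D'' ++ [y]) = C ++ [x] ++ (y :: D').reverse →
      (D'' ++ [y]).Perm (D ++ [u]) ∧ G.IsPathIn X (A ++ b :: (D'' ++ [y])) := by
    intro D'' h
    have hperm : (b :: (D'' ++ [y])).Perm (b :: (D ++ [u])) := by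
      rw [h, hM]
      have : C ++ x :: y :: D' = C ++ [x] ++ (y :: D') := by simp
      rw [this]
      exact (List.reverse_perm _).append_left _
    have hperm' := hperm.append_left A
    refine ⟨(List.perm_cons b).1 hperm, hperm'.nodup_iff.2 hP.1, ?_,
      fun z hz => hP.2.2 z (hperm'.mem_iff.1 hz)⟩
    rw [h]
    have hc := hP.2.1
    have e : A ++ b :: (D ++ [u]) = (A ++ C) ++ [x] ++ (y :: D') := by rw [hM]; simp
    rw [e] at hc
    simpa using hc.rotate_end hlast hux
  cases C with
  | nil =>
    rw [List.nil_append, List.cons.injEq] at hCE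
    exact ⟨D'.reverse, key _ (by simp [hCE.1])⟩
  | cons c C =>
    rw [List.cons_append, List.cons.injEq] at hCE
    exact ⟨C ++ x :: D'.reverse, key _ (by simp [hCE.1])⟩

lemma getD_idxOf_pred {α : Type*} [DecidableEq α] {M C D : List α} {x y z : α} (hM : M.Nodup)
    (h : M = C ++ x :: y :: D) : M.getD (M.idxOf y - 1) z = x := by
  subst h
  have h1 : (C ++ x :: y :: D).idxOf y = C.length + 1 := by
    have hl : C.length + 1 < (C ++ x :: y :: D).length := by simp
    have e : (C ++ x :: y :: D)[C.length + 1] = y := by simp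
    have := List.Nodup.idxOf_getElem hM (C.length + 1) hl
    rwa [e] at this
  rw [h1]
  simp

theorem mul_card_cliquesIn_add_le {K : ℕ} (hK : 1 ≤ K)
    (hG : ∀ L : List α, L.Nodup → L.IsChain G.Adj → K + 2 ≤ L.length → ∀ h : L ≠ [],
      ¬ G.Adj (L.getLast h) (L.head h)) (N : ℕ) (X : Finset α) (hX : #X = N + 1) :
    K * #(G.cliquesIn X) + 2 * N ≤ 2 * K + N * 2 ^ (K + 1) := by
  classical
  induction N using Nat.strong_induction_on generalizing X with
  | _ N ih =>
  rcases Nat.eq_zero_or_pos N with rfl | hN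
  · have h : #(G.cliquesIn X) ≤ #X.powerset := card_le_card (filter_subset _ _)
    rw [card_powerset, hX] at h
    have := Nat.mul_le_mul_left K h
    omega
  by_cases hE : ∃ x ∈ X, ∃ y ∈ X, G.Adj x y
  · obtain ⟨x, hx, y, hy, hxy⟩ := hE
    obtain ⟨L, hL, h2, hmax⟩ := exists_longest_isPathIn hx hy hxy
    obtain ⟨A, b, B, rfl, hB1, hBK, hAB⟩ := exists_split_longest hK h2
    set S : Finset α := {u ∈ X | ∃ D, (D ++ [u]).Perm B ∧ G.IsPathIn X (A ++ b :: (D ++ [u]))}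
      with hS
    set W : Finset α := (b :: B).toFinset with hW
    have hbB : (b :: B).Nodup := (List.nodup_append.1 hL.1).2.1
    have hSB : S ⊆ B.toFinset := by
      intro u hu
      obtain ⟨D, hD, -⟩ := (mem_filter.1 hu).2
      exact List.mem_toFinset.2 (hD.mem_iff.1 (by simp))
    have hBcard : #B.toFinset = B.length := List.toFinset_card_of_nodup (List.nodup_cons.1 hbB).2
    have hWcard : #W = B.length + 1 := List.toFinset_card_of_nodup hbB
    have hSK : #S ≤ B.length := hBcard ▸ card_le_card hSB
    have hSX : S ⊆ X := filter_subset _ _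
    have hbS : b ∉ S := fun h => (List.nodup_cons.1 hbB).1 (List.mem_toFinset.1 (hSB h))
    have hbX : b ∈ X := hL.2.2 b (by simp)
    have hSpos : 1 ≤ #S := by
      apply card_pos.2
      have hne : B ≠ [] := List.ne_nil_of_length_pos hB1
      have e := List.dropLast_append_getLast hne
      refine ⟨B.getLast hne, mem_filter.2 ⟨hL.2.2 _ ?_, B.dropLast, by rw [e], by rw [e]; exact hL⟩⟩
      simp [List.getLast_mem hne]
    have hnb : ∀ u ∈ S, ∃ D, (D ++ [u]).Perm B ∧ G.IsPathIn X (A ++ b :: (D ++ [u])) ∧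
        ∀ x ∈ X, G.Adj u x → x ∈ b :: D := by
      intro u hu
      obtain ⟨D, hD, hP⟩ := (mem_filter.1 hu).2
      refine ⟨D, hD, hP, fun x hx hux => mem_of_adj_end hG hP ?_ ?_ hx hux⟩
      · simpa [← hD.length_eq] using hmax
      · simpa only [hD.length_eq] using hAB
    have hcl := G.card_cliquesIn_le_sdiff X W S #S
      (hSB.trans fun z hz => by simp only [hW, List.mem_toFinset, List.mem_cons] at hz ⊢; tauto)
      (by
        intro u hu x hx hux
        obtain ⟨D, hD, -, h⟩ := hnb u hu
        have := h x hx hux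
        rw [List.mem_cons] at this
        rw [hW, List.mem_toFinset, List.mem_cons]
        exact this.imp id fun hxD => hD.mem_iff.1 (List.mem_append_left _ hxD))
      (by
        intro u hu
        obtain ⟨D, hD, hP, h⟩ := hnb u hu
        have hM : (b :: (D ++ [u])).Nodup := (List.nodup_append.1 hP.1).2.1
        -- Each neighbour of `u` precedes some rotation endpoint on the current path, so the degree
        -- is at most `#S`. The default value `u` is never reached.
        have hsub : {x ∈ X | G.Adj u x} ⊆
            S.image (fun y => (b :: (D ++ [u])).getD ((b :: (D ++ [u])).idxOf y - 1) u) := by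
          intro x hx
          obtain ⟨hxX, hux⟩ := mem_filter.1 hx
          obtain ⟨C, y, D', hC, D'', hperm, hP'⟩ := exists_rotation hP (h x hxX hux) hux
          refine mem_image.2 ⟨y, mem_filter.2 ⟨hP'.2.2 y (by simp), D'', hperm.trans hD, hP'⟩, ?_⟩
          exact getD_idxOf_pred hM hC
        exact (card_le_card hsub).trans card_image_le)
    have hmono : ∑ i ∈ range #S, 2 ^ min #S (#W - 1 - i) ≤ ∑ i ∈ range #S, 2 ^ min #S (K - i) := by
      refine sum_le_sum fun i _ => Nat.pow_le_pow_right (by norm_num) ?_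
      apply min_le_min_left
      omega
    have hnum := mul_sum_two_pow_min_add_le #S K hSpos (hSK.trans hBK)
    have hlt : #S < #X := card_lt_card ⟨hSX, fun h => hbS (h hbX)⟩
    obtain ⟨r, hr⟩ : ∃ r, N = r + #S := ⟨N - #S, by omega⟩
    have hi := ih r (by omega) (X \ S) (by rw [card_sdiff_of_subset hSX]; omega)
    have hfin := Nat.mul_le_mul_left K (hcl.trans (Nat.add_le_add_left hmono _))
    rw [mul_add] at hfin
    rw [hr, add_mul]
    omega
  · push Not at hE
    obtain ⟨u, hu⟩ : X.Nonempty := card_pos.1 (by omega)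
    have h := G.card_cliquesIn_le_erase X u
    have h0 : #{x ∈ X | G.Adj u x} = 0 := by
      rw [card_eq_zero, filter_eq_empty_iff]
      exact fun x hx => hE u hu x hx
    rw [h0, pow_zero] at h
    obtain ⟨r, rfl⟩ : ∃ r, N = r + 1 := ⟨N - 1, by omega⟩
    have hi := ih r (by omega) (X.erase u) (by rw [card_erase_of_mem hu]; omega)
    have h1 : K + 1 ≤ 2 ^ K := Nat.lt_two_pow_self
    have h2 : 2 ^ (K + 1) = 2 * 2 ^ K := by ring
    have h3 := Nat.mul_le_mul_left K h
    rw [mul_add] at h3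
    rw [add_mul]
    omega

end SimpleGraph

/-! ### From hypergraphs to graphs -/

lemma pair_injective_of_cycle {α : Type*} [DecidableEq α] {m : ℕ} (hm : 2 ≤ m)
    {v : Fin (m + 1) → α} (hv : Function.Injective v) :
    Function.Injective fun i => ({v i, v (i + 1)} : Finset α) := by
  intro i j hij
  have hij' : ({v i, v (i + 1)} : Finset α) = {v j, v (j + 1)} := hij
  have h1 : v i ∈ ({v j, v (j + 1)} : Finset α) := hij' ▸ by simp
  have h2 : v (i + 1) ∈ ({v j, v (j + 1)} : Finset α) := hij' ▸ by simp
  simp only [mem_insert, mem_singleton, hv.eq_iff] at h1 h2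
  rcases h1 with h1 | h1
  · exact h1
  · rcases h2 with h2 | h2
    · exfalso
      rw [h1, add_assoc, add_eq_left] at h2
      have := congrArg Fin.val h2
      rw [Fin.val_add, Fin.val_one', Fin.val_zero, Nat.mod_eq_of_lt (a := 1) (by omega),
        Nat.mod_eq_of_lt (by omega)] at this
      omega
    · exact add_right_cancel h2

lemma List.adj_getElem_add_one {α : Type*} {G : SimpleGraph α} {L : List α} {m : ℕ}
    (hL : L.length = m + 1) (hc : L.IsChain G.Adj) (h : L ≠ [])
    (hlast : G.Adj (L.getLast h) (L.head h)) (i : Fin (m + 1)) :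
    G.Adj (L[i.1]'(by omega)) (L[(i + 1).1]'(by rw [hL]; exact (i + 1).isLt)) := by
  rcases Fin.eq_castSucc_or_eq_last i with ⟨j, rfl⟩ | rfl
  · have := List.isChain_iff_getElem.1 hc j.1 (by omega)
    simpa using this
  · rw [List.getLast_eq_getElem, List.head_eq_getElem] at hlast
    simpa [hL] using hlast

namespace Hypergraph

variable {α : Type*}

lemma hasBergeCycle_of_cycle {H : Hypergraph α} [DecidableEq α] {P : Finset (Finset α)}
    {f : {p // p ∈ P} → Finset α} (hf : Function.Injective f)
    (hfH : ∀ p, (f p : Set α) ∈ H.edgeSet) (hfP : ∀ p, p.1 ⊆ f p) {m : ℕ} (hm : 2 ≤ m)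
    {v : Fin (m + 1) → α} (hv : Function.Injective v)
    (hP : ∀ i, ({v i, v (i + 1)} : Finset α) ∈ P) : H.HasBergeCycle (m + 1) := by
  have hsub : ∀ i, v i ∈ f ⟨_, hP i⟩ ∧ v (i + 1) ∈ f ⟨_, hP i⟩ := fun i =>
    ⟨hfP ⟨_, hP i⟩ (by simp), hfP ⟨_, hP i⟩ (by simp)⟩
  refine ⟨by omega, v, fun i => f ⟨_, hP i⟩, hv, ?_, ?_, fun i => hfH _, ?_⟩
  · intro i j hij
    exact pair_injective_of_cycle hm hv (Subtype.mk.inj (hf (coe_injective hij)))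
  · exact fun i => H.subset_vertexSet_of_mem_edgeSet' (hfH ⟨_, hP i⟩) (hsub i).1
  · intro i x hx
    rw [finRotate_apply] at hx
    rcases hx with rfl | rfl
    · exact (hsub i).1
    · exact (hsub i).2

/-- Long Berge cycles being excluded, the hyperedges are at most as many as the cliques of some
graph on the same vertices without long cycles. -/
theorem exists_graph_card_le_cliquesIn (H : Hypergraph α) (V : Finset α)
    (hV : H.vertexSet = V) (k : ℕ) (hk : 3 ≤ k) (hH : ∀ ℓ, k ≤ ℓ → ¬ H.HasBergeCycle ℓ) :
    ∃ G : SimpleGraph α,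
      (∀ L : List α, L.Nodup → L.IsChain G.Adj → k ≤ L.length → ∀ h : L ≠ [],
        ¬ G.Adj (L.getLast h) (L.head h)) ∧
      H.edgeSet.ncard ≤ #(G.cliquesIn V) := by
  classical
  set E : Finset (Finset α) := {s ∈ V.powerset | (s : Set α) ∈ H.edgeSet} with hE
  have hcard : H.edgeSet.ncard = #E := by
    rw [← Set.ncard_coe_finset, ← Set.ncard_image_of_injective _ (coe_injective (α := α))]
    congr 1
    ext s
    simp only [hE, coe_filter, mem_powerset, Set.mem_image, Set.mem_ofPred_eq]
    constructor
    · intro hs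
      have hsV : s ⊆ (V : Set α) := hV ▸ H.subset_vertexSet_of_mem_edgeSet' hs
      have hfin : s.Finite := V.finite_toSet.subset hsV
      refine ⟨hfin.toFinset, ⟨?_, by simpa using hs⟩, by simp⟩
      rw [← coe_subset]
      simpa using hsV
    · rintro ⟨x, ⟨-, hx⟩, rfl⟩
      exact hx
  obtain ⟨A, hA, P, f, g, hf, hfE, hg, hgP, hAP⟩ := exists_matched_set E (fun e => e.powersetCard 2)
  simp only [mem_powersetCard] at hfE hgP hAP
  let G : SimpleGraph α :=
    { Adj := fun x y => x ≠ y ∧ ({x, y} : Finset α) ∈ P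
      symm := ⟨fun x y h => ⟨h.1.symm, by rw [pair_comm]; exact h.2⟩⟩
      loopless := ⟨fun x h => h.1 rfl⟩ }
  refine ⟨G, ?_, ?_⟩
  · intro L hnd hc hlen hne hadj
    obtain ⟨m, hm⟩ : ∃ m, L.length = m + 1 := ⟨L.length - 1, by omega⟩
    refine hH (m + 1) (by omega) (hasBergeCycle_of_cycle (v := fun i => L[i.1]) hf
      (fun p => (mem_filter.1 (hfE p).1).2) (fun p => (hfE p).2.1) (by omega) ?_
      (fun i => (List.adj_getElem_add_one hm hc hne hadj i).2))
    intro i j hij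
    exact Fin.ext ((List.Nodup.getElem_inj_iff hnd).1 hij)
  · rw [hcard]
    -- A pair `g e` lying in `A` would be a pair contained in a member of `A`, namely itself, which
    -- the matching avoids.
    have hdisj : Disjoint A (univ.image g) := by
      rw [disjoint_left]
      intro a ha hmem
      obtain ⟨e, -, rfl⟩ := mem_image.1 hmem
      exact (hAP _ ha).2 e ⟨Subset.rfl, (hgP e).2.2⟩
    have hsum : #E = #(A ∪ univ.image g) := by
      rw [card_union_of_disjoint hdisj, card_image_of_injective _ hg, card_univ, Fintype.card_coe,
        card_sdiff_of_subset hA]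
      have := card_le_card hA
      omega
    rw [hsum]
    apply card_le_card
    intro Q hQ
    rw [SimpleGraph.mem_cliquesIn]
    rw [mem_union, mem_image] at hQ
    rcases hQ with hQ | ⟨e, -, rfl⟩
    · refine ⟨mem_powerset.1 (mem_filter.1 (hA hQ)).1, ?_⟩
      intro x hx y hy hxy
      refine ⟨hxy, (hAP Q hQ).1 (mem_powersetCard.2 ⟨?_, card_pair hxy⟩)⟩
      exact insert_subset hx (singleton_subset_iff.2 hy)
    · refine ⟨(hgP e).2.1.trans (mem_powerset.1 (mem_filter.1 (mem_sdiff.1 e.2).1).1), ?_⟩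
      obtain ⟨x, y, hxy, he⟩ := card_eq_two.1 (hgP e).2.2
      have hmem := (hgP e).1
      rw [he] at hmem ⊢
      rw [coe_pair, SimpleGraph.isClique_pair]
      exact fun h => ⟨h, hmem⟩

theorem card_edgeSet_le_of_no_long_bergeCycle {n k : ℕ} (hk : 3 ≤ k) (hkn : k ≤ n)
    (H : Hypergraph α) (hn : H.vertexSet.ncard = n) (hH : ∀ ℓ, k ≤ ℓ → ¬ H.HasBergeCycle ℓ) :
    (H.edgeSet.ncard : ℝ) ≤ 2 + ((n : ℝ) - 1) / ((k : ℝ) - 2) * ((2 : ℝ) ^ (k - 1) - 2) := by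
  have hfin : H.vertexSet.Finite := Set.finite_of_ncard_pos (by omega)
  obtain ⟨G, hG, hle⟩ := H.exists_graph_card_le_cliquesIn hfin.toFinset (by simp) k hk hH
  obtain ⟨K, rfl⟩ : ∃ K, k = K + 2 := ⟨k - 2, by omega⟩
  obtain ⟨N, rfl⟩ : ∃ N, n = N + 1 := ⟨n - 1, by omega⟩
  have h := SimpleGraph.mul_card_cliquesIn_add_le (by omega) hG N hfin.toFinset
    (by rw [← hn, Set.ncard_eq_toFinset_card _ hfin])
  have h' := (Nat.add_le_add_right (Nat.mul_le_mul_left K hle) (2 * N)).trans h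
  have hR : (K : ℝ) * H.edgeSet.ncard + 2 * N ≤ 2 * K + N * 2 ^ (K + 1) := by exact_mod_cast h'
  have hK : (0 : ℝ) < K := by exact_mod_cast (by omega : 0 < K)
  have e : K + 2 - 1 = K + 1 := rfl
  rw [e]
  push_cast
  rw [add_sub_cancel_right, add_sub_cancel_right, div_mul_eq_mul_div, ← sub_le_iff_le_add',
    le_div_iff₀ hK]
  linarith

end Hypergraph

/-! ### The extremal construction -/

namespace Hypergraph

variable {α : Type*} {m K : ℕ}

open Classical in
/-- Identifying `α` with `m` disjoint `K`-sets and one additional point, the union of the `j`-th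
set and the additional point. -/
noncomputable def sail (φ : α ≃ Option (Fin m × Fin K)) (j : Fin m) : Finset α :=
  univ.image fun b : Option (Fin K) => φ.symm (b.map fun i => (j, i))

/-- The hypergraph of all subsets of sails. -/
def windmill (φ : α ≃ Option (Fin m × Fin K)) : Hypergraph α where
  vertexSet := Set.univ
  edgeSet := {s | ∃ j, s ⊆ sail φ j}
  subset_vertexSet_of_mem_edgeSet' _ _ := Set.subset_univ _

variable (φ : α ≃ Option (Fin m × Fin K))

lemma mem_sail {j : Fin m} {x : α} :
    x ∈ sail φ j ↔ x = φ.symm none ∨ ∃ i, x = φ.symm (some (j, i)) := by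
  simp [sail, Option.exists, eq_comm]

lemma card_sail (j : Fin m) : #(sail φ j) = K + 1 := by
  classical
  rw [sail, card_image_of_injective, card_univ, Fintype.card_option, Fintype.card_fin]
  exact φ.symm.injective.comp (Option.map_injective fun a b h => (Prod.mk.inj h).2)

lemma eq_of_mem_sail {j j' : Fin m} {x : α} (h : x ∈ sail φ j) (h' : x ∈ sail φ j')
    (hx : x ≠ φ.symm none) : j = j' := by
  obtain ⟨i, rfl⟩ := ((mem_sail φ).1 h).resolve_left hx
  obtain ⟨i', hi'⟩ := ((mem_sail φ).1 h').resolve_left hx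
  simpa using congrArg Prod.fst (Option.some.inj (φ.symm.injective hi'))

/-- Distinct sails meet only in the hub, which a Berge cycle visits at most once. Traversed from
there, the cycle never leaves one sail, so it has at most `K + 1` vertices. -/
lemma windmill_not_hasBergeCycle {ℓ : ℕ} (hℓ : K + 2 ≤ ℓ) : ¬ (windmill φ).HasBergeCycle ℓ := by
  rintro ⟨-, v, e, hv, -, -, he, hve⟩
  obtain ⟨p, rfl⟩ : ∃ p, ℓ = p + 1 := ⟨ℓ - 1, by omega⟩
  choose c hc using he
  have h1 : ∀ i, v i ∈ sail φ (c i) := fun i => hc i (hve i (by simp))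
  have h2 : ∀ i, v (i + 1) ∈ sail φ (c i) := fun i =>
    hc i (hve i (by simp [finRotate_apply]))
  obtain ⟨a, ha⟩ : ∃ a, ∀ i, i ≠ a → v i ≠ φ.symm none := by
    by_cases h : ∃ a, v a = φ.symm none
    · obtain ⟨a, ha⟩ := h
      exact ⟨a, fun i hi h => hi (hv (h.trans ha.symm))⟩
    · exact ⟨0, fun i _ h' => h ⟨i, h'⟩⟩
  have hall : ∀ t : Fin (p + 1), v (a + t) ∈ sail φ (c a) := by
    intro t
    induction t using Fin.induction with
    | zero => simpa using h1 a
    | succ t ih =>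
      have h := h2 (a + t.castSucc)
      rw [add_assoc, Fin.coeSucc_eq_succ] at h
      rcases eq_or_ne t.castSucc 0 with h0 | h0
      · rwa [h0, add_zero] at h
      · rwa [eq_of_mem_sail φ ih (h1 _) (ha _ (by simpa using h0))]
  have hcard : #(univ.map ⟨v, hv⟩) ≤ #(sail φ (c a)) := by
    apply card_le_card
    intro x hx
    obtain ⟨i, -, rfl⟩ := mem_map.1 hx
    simpa using hall (i - a)
  rw [card_map, card_univ, Fintype.card_fin, card_sail] at hcard
  omega

lemma ncard_windmill_edgeSet (hm : 0 < m) :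
    (windmill φ).edgeSet.ncard = 2 + m * (2 ^ (K + 1) - 2) := by
  classical
  set r := φ.symm none with hr
  have hrs : ∀ j, r ∈ sail φ j := fun j => (mem_sail φ).2 (Or.inl rfl)
  -- Only the empty set and the hub singleton are shared between sails; every other edge lies in
  -- exactly one.
  have hT : #({∅, {r}} : Finset (Finset α)) = 2 := card_pair (by simp)
  have hTs : ∀ j, ({∅, {r}} : Finset (Finset α)) ⊆ (sail φ j).powerset := by
    intro j Q hQ
    rw [mem_insert, mem_singleton] at hQ
    rcases hQ with rfl | rfl <;> simp [hrs j]
  set U := univ.biUnion fun j => (sail φ j).powerset \ ({∅, {r}} : Finset (Finset α)) with hU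
  have hUcard : #U = m * (2 ^ (K + 1) - 2) := by
    rw [hU, card_biUnion]
    · simp [card_sdiff_of_subset (hTs _), hT, card_sail]
    · intro j _ j' _ hjj'
      rw [Function.onFun, disjoint_left]
      intro Q hQ hQ'
      rw [mem_sdiff, mem_powerset] at hQ hQ'
      apply hQ.2
      rw [mem_insert, mem_singleton, ← subset_singleton_iff]
      intro x hx
      rw [mem_singleton]
      by_contra hxr
      exact hjj' (eq_of_mem_sail φ (hQ.1 hx) (hQ'.1 hx) hxr)
  have hcard : #({∅, {r}} ∪ U) = 2 + m * (2 ^ (K + 1) - 2) := by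
    rw [card_union_of_disjoint, hT, hUcard]
    rw [disjoint_left]
    intro Q hQ hQU
    obtain ⟨j, -, h⟩ := mem_biUnion.1 hQU
    exact (mem_sdiff.1 h).2 hQ
  rw [← hcard, ← Set.ncard_coe_finset, ← Set.ncard_image_of_injective _ (coe_injective (α := α))]
  congr 1
  ext s
  rw [Set.mem_image]
  constructor
  · rintro ⟨j, hj⟩
    have hfin : s.Finite := (sail φ j).finite_toSet.subset hj
    refine ⟨hfin.toFinset, ?_, by simp⟩
    rw [mem_coe, mem_union]
    by_cases h : hfin.toFinset ∈ ({∅, {r}} : Finset (Finset α))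
    · exact Or.inl h
    · refine Or.inr (mem_biUnion.2 ⟨j, mem_univ j, mem_sdiff.2 ⟨mem_powerset.2 ?_, h⟩⟩)
      rw [← coe_subset]
      simpa using hj
  · rintro ⟨Q, hQ, rfl⟩
    rw [mem_coe, mem_union] at hQ
    rcases hQ with hQ | hQ
    · exact ⟨⟨0, hm⟩, coe_subset.2 (mem_powerset.1 (hTs _ hQ))⟩
    · obtain ⟨j, -, h⟩ := mem_biUnion.1 hQ
      exact ⟨j, coe_subset.2 (mem_powerset.1 (mem_sdiff.1 h).1)⟩

theorem exists_no_long_bergeCycle_card_edgeSet_eq {n k : ℕ} (hk : 3 ≤ k) (hkn : k ≤ n)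
    (h : n ≡ 1 [MOD (k - 2)]) :
    ∃ H : Hypergraph (Fin n), H.vertexSet = Set.univ ∧
      (∀ ℓ : ℕ, k ≤ ℓ → ¬ H.HasBergeCycle ℓ) ∧
      (H.edgeSet.ncard : ℝ) = 2 + ((n : ℝ) - 1) / ((k : ℝ) - 2) * ((2 : ℝ) ^ (k - 1) - 2) := by
  obtain ⟨K, rfl⟩ : ∃ K, k = K + 2 := ⟨k - 2, by omega⟩
  obtain ⟨N, rfl⟩ : ∃ N, n = N + 1 := ⟨n - 1, by omega⟩
  rw [Nat.add_sub_cancel] at h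
  obtain ⟨m, rfl⟩ : K ∣ N := by
    simpa using (Nat.modEq_iff_dvd' (by omega)).1 h.symm
  have hm : 0 < m := Nat.pos_of_ne_zero (by rintro rfl; omega)
  let φ : Fin (K * m + 1) ≃ Option (Fin m × Fin K) :=
    Fintype.equivOfCardEq (by simp [mul_comm])
  refine ⟨windmill φ, rfl, fun ℓ hℓ => windmill_not_hasBergeCycle φ hℓ, ?_⟩
  have hK : (K : ℝ) ≠ 0 := by exact_mod_cast (by omega : K ≠ 0)
  have h2 : 2 ≤ 2 ^ (K + 1) := by
    rw [pow_succ]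
    have := Nat.one_le_two_pow (n := K)
    omega
  rw [ncard_windmill_edgeSet φ hm]
  have e : K + 2 - 1 = K + 1 := rfl
  rw [e]
  push_cast [h2]
  rw [add_sub_cancel_right, add_sub_cancel_right, mul_div_cancel_left₀ _ hK]

end Hypergraph

theorem theorem2p4 (n k : ℕ) (hk : 3 ≤ k) (hkn : k ≤ n) :
    (∀ (α : Type*) (H : Hypergraph α), H.vertexSet.ncard = n →
      (∀ ℓ : ℕ, k ≤ ℓ → ¬ H.HasBergeCycle ℓ) →
      (H.edgeSet.ncard : ℝ) ≤ 2 + ((n : ℝ) - 1) / ((k : ℝ) - 2) * ((2 : ℝ) ^ (k - 1) - 2)) ∧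
    (n ≡ 1 [MOD (k - 2)] →
      ∃ H : Hypergraph (Fin n), H.vertexSet = Set.univ ∧
        (∀ ℓ : ℕ, k ≤ ℓ → ¬ H.HasBergeCycle ℓ) ∧
        (H.edgeSet.ncard : ℝ) = 2 + ((n : ℝ) - 1) / ((k : ℝ) - 2) * ((2 : ℝ) ^ (k - 1) - 2)) := by
  exact ⟨fun _ H hn hH => H.card_edgeSet_le_of_no_long_bergeCycle hk hkn hn hH,
    Hypergraph.exists_no_long_bergeCycle_card_edgeSet_eq hk hkn⟩
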